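/- Let $n,p\in\mathbb{N}$ with $p$ even and $n>p$, and let $\lambda>0$. For $1\le k\le p/2$ let $\mathbf{M}_k\in\mathbb{R}^{p\times p}$ be the matrix whose $(i,j)$ entry is $1$ if ($i=k$ and $k+1\le j\le p$) or ($j=k$ and $k+1\le i\le p$), and $0$ otherwise, and let $$\mathcal{F}^*=\Big\{\boldsymbol{\Sigma}_{\boldsymbol{\theta}}=\mathbf{Id}+\frac{1}{2\sqrt{np}}\sum_{k=1}^{p/2}\theta_k\mathbf{M}_k \;:\; \boldsymbol{\theta}\in\{0,1\}^{p/2}\Big\}.$$ For $\boldsymbol{\Sigma}\in\mathcal{F}^*$ let $\mathbf{Y}^1,\dots,\mathbf{Y}^n$ be i.i.d. copies of $\mathbf{Y}=\mathrm{sign}(\mathbf{X}+\boldsymbol{\tau})\in\{-1,1\}^p$, where $\mathbf{X}\sim\mathcal{N}(\mathbf{0},\boldsymbol{\Sigma})$ and $\boldsymbol{\tau}\sim\mathrm{Unif}([-\lambda,\lambda]^p)$ are independent, and $\mathrm{sign}$ acts componentwise with $\mathrm{sign}(x)=1$ for $x\ge 0$ and $\mathrm{sign}(x)=-1$ for $x<0$.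 Then $$\inf_{\hat{\boldsymbol{\Sigma}}}\ \sup_{\boldsymbol{\Sigma}\in\mathcal{F}^*}\ \mathbb{E}\,\big\|\hat{\boldsymbol{\Sigma}}(\mathbf{Y}^1,\dots,\mathbf{Y}^n)-\boldsymbol{\Sigma}\big\|^2\ \ge\ c\,\frac{p}{n},$$ where the infimum is over all estimators, that is, all functions $\hat{\boldsymbol{\Sigma}}:(\{-1,1\}^p)^n\to\mathbb{R}^{p\times p}$, $\|\cdot\|$ is the operator norm (largest singular value), and $c>0$ is an absolute constant, independent of $n$, $p$ and $\lambda$. -/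

import Mathlib

open MeasureTheory ProbabilityTheory
open scoped ENNReal

namespace DitheredCov

/-- The sign of a real number, with values in `ℤˣ = {1, -1}` and `sign 0 = 1`. -/
noncomputable def sgn (t : ℝ) : ℤˣ := if 0 ≤ t then 1 else -1

/-- The dithered one-bit quantizer `sign (x + τ)`, acting componentwise. -/
noncomputable def quantize {p : ℕ} (x : EuclideanSpace ℝ (Fin p)) (τ : Fin p → ℝ) :
    Fin p → ℤˣ :=
  fun i => sgn (x i + τ i)

/-- The uniform distribution on the cube `[-lam, lam]^p`. -/
noncomputable def ditherLaw (p : ℕ) (lam : ℝ) : Measure (Fin p → ℝ) :=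
  cond volume (Set.Icc (fun _ => -lam) (fun _ => lam))

/-- The law of `Y = sign (X + τ)` on `{-1, 1}^p`, where `X ∼ N(0, S)` and
`τ ∼ Unif([-lam, lam]^p)` are independent. -/
noncomputable def quantizedLaw {p : ℕ} (lam : ℝ) (S : Matrix (Fin p) (Fin p) ℝ) :
    Measure (Fin p → ℤˣ) :=
  ((multivariateGaussian 0 S).prod (ditherLaw p lam)).map (fun z => quantize z.1 z.2)

/-- The law of `n` independent copies `Y¹, …, Yⁿ` of `Y`. -/
noncomputable def sampleLaw {p : ℕ} (n : ℕ) (lam : ℝ) (S : Matrix (Fin p) (Fin p) ℝ) :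
    Measure (Fin n → Fin p → ℤˣ) :=
  Measure.pi (fun _ => quantizedLaw lam S)

/-- The matrix with ones in row `k` and column `k`, strictly to the right of, respectively strictly
below, the diagonal entry `(k, k)`, and zeros elsewhere. -/
def rowColMatrix (p k : ℕ) : Matrix (Fin p) (Fin p) ℝ :=
  Matrix.of fun i j =>
    if ((i : ℕ) = k ∧ k < (j : ℕ)) ∨ ((j : ℕ) = k ∧ k < (i : ℕ)) then 1 else 0

/-- The perturbed identity matrix with parameter `θ ∈ {0, 1}^(p/2)`. -/
noncomputable def perturbedId (n p : ℕ) (θ : Fin (p / 2) → Fin 2) : Matrix (Fin p) (Fin p) ℝ :=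
  1 + (1 / (2 * Real.sqrt ((n : ℝ) * (p : ℝ)))) •
    ∑ k : Fin (p / 2), (((θ k : ℕ) : ℝ) • rowColMatrix p (k : ℕ))

/-- The family of all perturbed identity matrices, for sample size `n` in dimension `p`. -/
def perturbedFamily (n p : ℕ) : Set (Matrix (Fin p) (Fin p) ℝ) :=
  Set.range (perturbedId n p)

open scoped Matrix.Norms.L2Operator in
/-- The mean squared error, in the operator norm on `ℓ²`, of the estimator `est`, as a number in
`[0, ∞]`. The sample space is finite and discrete, so every function on it is measurable. -/
noncomputable def risk {n p : ℕ} (lam : ℝ)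
    (est : (Fin n → Fin p → ℤˣ) → Matrix (Fin p) (Fin p) ℝ)
    (S : Matrix (Fin p) (Fin p) ℝ) : ℝ≥0∞ :=
  ∫⁻ y, ENNReal.ofReal (‖est y - S‖ ^ 2) ∂(sampleLaw n lam S)

/-- The minimax risk over a class `F` of covariance matrices: the infimum is over all estimators,
that is, all matrix-valued functions of the quantized sample. -/
noncomputable def minimaxRisk (n p : ℕ) (lam : ℝ) (F : Set (Matrix (Fin p) (Fin p) ℝ)) : ℝ≥0∞ :=
  ⨅ est : (Fin n → Fin p → ℤˣ) → Matrix (Fin p) (Fin p) ℝ, ⨆ S ∈ F, risk lam est S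

/-- The inherited measurable structure on `ℤˣ = {1, -1}` is the discrete one. -/
instance instDiscreteSign : DiscreteMeasurableSpace ℤˣ where
  forall_measurableSet s :=
    ⟨Units.val '' s, MeasurableSet.of_discrete, Set.preimage_image_eq s Units.val_injective⟩

theorem measurable_quantize (p : ℕ) :
    Measurable (fun z : EuclideanSpace ℝ (Fin p) × (Fin p → ℝ) => quantize z.1 z.2) := by
  refine measurable_pi_lambda _ fun i => ?_
  unfold quantize sgn
  refine Measurable.ite ?_ measurable_const measurable_const
  exact measurableSet_le measurable_const (by fun_prop)

theorem isProbabilityMeasure_ditherLaw (p : ℕ) {lam : ℝ} (hl : 0 < lam) :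
    IsProbabilityMeasure (ditherLaw p lam) := by
  refine cond_isProbabilityMeasure_of_finite ?_ ?_
  · rw [Real.volume_Icc_pi]
    simp [hl]
  · exact isCompact_Icc.measure_lt_top.ne

theorem isProbabilityMeasure_quantizedLaw {p : ℕ} {lam : ℝ} (hl : 0 < lam)
    (S : Matrix (Fin p) (Fin p) ℝ) : IsProbabilityMeasure (quantizedLaw lam S) := by
  have := isProbabilityMeasure_ditherLaw p hl
  exact Measure.isProbabilityMeasure_map (measurable_quantize p).aemeasurable

end DitheredCov

/-!
Write `Σ_θ` for `perturbedId n p θ`. Two matrices `Σ_θ`, `Σ_η` with `θ, η` differing in one bit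
are at squared Frobenius distance at most `1 / (2 n)`, while all `Σ_θ` are bounded below by `1 / 2`.
After a simultaneous diagonalization the two Gaussian laws become products of one-dimensional ones,
and the `χ²`-divergence of their `n`-fold products is bounded by an absolute constant. Quantization
can only decrease it, which is why the dithering level plays no role, so no test based on the
quantized sample tells `θ` from `η` reliably. By Assouad's lemma every estimator of `θ` then gets a
constant fraction of the `p / 2` bits wrong. In turn, every wrong bit costs an estimator of `Σ_θ` a
squared operator norm error of order `1 / n`: applying `Σ_θ` to the indicator vector of the upper
half of the coordinates, of squared norm about `p / 2`, displays the `k`-th bit of `θ` in the `k`-th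
coordinate, amplified by `p / 2` times the scale `1 / (2 √(n p))` of the perturbation.
-/

namespace DitheredCov

section ChiSqBound

variable {Ω Ω' : Type*} [MeasurableSpace Ω] [MeasurableSpace Ω'] {P Q : Measure Ω} {C : ℝ≥0∞}

/-- The probability measure `P` is within `χ²`-divergence `C - 1` of the probability measure `Q`.
The second moment of the likelihood ratio is encoded through its variational characterization
as the best constant in `(∫ g dP)² ≤ C ∫ g² dQ`, which is stable under products and images without
any reference to densities. -/
def ChiSqBound (P Q : Measure Ω) (C : ℝ≥0∞) : Prop :=
  ∀ g : Ω → ℝ≥0∞, Measurable g → (∫⁻ x, g x ∂P) ^ 2 ≤ C * ∫⁻ x, g x ^ 2 ∂Q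

theorem sq_lintegral_mul_le (μ : Measure Ω) {f g : Ω → ℝ≥0∞} (hf : AEMeasurable f μ)
    (hg : AEMeasurable g μ) :
    (∫⁻ x, f x * g x ∂μ) ^ 2 ≤ (∫⁻ x, f x ^ 2 ∂μ) * ∫⁻ x, g x ^ 2 ∂μ := by
  have holder := ENNReal.lintegral_mul_le_Lp_mul_Lq μ Real.HolderConjugate.two_two hf hg
  calc (∫⁻ x, f x * g x ∂μ) ^ 2
      ≤ ((∫⁻ x, f x ^ 2 ∂μ) ^ (1 / 2 : ℝ) * (∫⁻ x, g x ^ 2 ∂μ) ^ (1 / 2 : ℝ)) ^ 2 := by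
        gcongr
        simpa using holder
    _ = _ := by
        rw [mul_pow, ← ENNReal.rpow_mul_natCast, ← ENNReal.rpow_mul_natCast]
        norm_num

theorem chiSqBound_withDensity {μ : Measure Ω} {p q r : Ω → ℝ≥0∞} (hp : Measurable p)
    (hq : Measurable q) (hr : Measurable r) (hpqr : ∀ x, p x ^ 2 ≤ q x * r x) :
    ChiSqBound (μ.withDensity p) (μ.withDensity q) (∫⁻ x, r x ∂μ) := by
  intro g hg
  have sqrt_sq (a : ℝ≥0∞) : (a ^ (1 / 2 : ℝ)) ^ 2 = a := by
    rw [← ENNReal.rpow_mul_natCast]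
    norm_num
  have p_le (x : Ω) : p x ≤ r x ^ (1 / 2 : ℝ) * q x ^ (1 / 2 : ℝ) := by
    rw [← ENNReal.pow_le_pow_left_iff two_ne_zero, mul_pow, sqrt_sq, sqrt_sq, mul_comm]
    exact hpqr x
  rw [lintegral_withDensity_eq_lintegral_mul _ hp hg,
    lintegral_withDensity_eq_lintegral_mul _ hq (hg.pow_const 2)]
  calc (∫⁻ x, (p * g) x ∂μ) ^ 2
      ≤ (∫⁻ x, r x ^ (1 / 2 : ℝ) * (q x ^ (1 / 2 : ℝ) * g x) ∂μ) ^ 2 := by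
        gcongr with x
        rw [Pi.mul_apply, ← mul_assoc]
        gcongr
        exact p_le x
    _ ≤ (∫⁻ x, (r x ^ (1 / 2 : ℝ)) ^ 2 ∂μ) * ∫⁻ x, (q x ^ (1 / 2 : ℝ) * g x) ^ 2 ∂μ :=
        sq_lintegral_mul_le μ (by fun_prop) (by fun_prop)
    _ = _ := by simp only [mul_pow, sqrt_sq, Pi.mul_apply]

namespace ChiSqBound

theorem mono {D : ℝ≥0∞} (h : ChiSqBound P Q C) (hCD : C ≤ D) : ChiSqBound P Q D :=
  fun g hg => (h g hg).trans (by gcongr)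

theorem refl (P : Measure Ω) [IsProbabilityMeasure P] : ChiSqBound P P 1 := by
  simpa using chiSqBound_withDensity (μ := P) (p := 1) (q := 1) (r := 1) measurable_one
    measurable_one measurable_one (by simp)

theorem map (h : ChiSqBound P Q C) {φ : Ω → Ω'} (hφ : Measurable φ) :
    ChiSqBound (P.map φ) (Q.map φ) C := by
  intro g hg
  rw [lintegral_map hg hφ, lintegral_map (hg.pow_const 2) hφ]
  exact h _ (hg.comp hφ)

theorem prod {P' Q' : Measure Ω'} [SFinite P'] [SFinite Q'] {C' : ℝ≥0∞}
    (h : ChiSqBound P Q C) (h' : ChiSqBound P' Q' C') :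
    ChiSqBound (P.prod P') (Q.prod Q') (C * C') := by
  intro g hg
  rw [lintegral_prod _ hg.aemeasurable, lintegral_prod _ (hg.pow_const 2).aemeasurable]
  calc (∫⁻ x, ∫⁻ y, g (x, y) ∂P' ∂P) ^ 2
      ≤ C * ∫⁻ x, (∫⁻ y, g (x, y) ∂P') ^ 2 ∂Q := h _ hg.lintegral_prod_right'
    _ ≤ C * ∫⁻ x, C' * ∫⁻ y, g (x, y) ^ 2 ∂Q' ∂Q := by
        gcongr with x
        exact h' _ (hg.comp measurable_prodMk_left)
    _ = C * C' * ∫⁻ x, ∫⁻ y, g (x, y) ^ 2 ∂Q' ∂Q := by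
        rw [lintegral_const_mul _ (hg.pow_const 2).lintegral_prod_right', mul_assoc]

theorem pi_fin {n : ℕ} {X : Fin n → Type*} [∀ i, MeasurableSpace (X i)]
    {P Q : ∀ i, Measure (X i)} [∀ i, SigmaFinite (P i)] [∀ i, SigmaFinite (Q i)]
    {C : Fin n → ℝ≥0∞} (h : ∀ i, ChiSqBound (P i) (Q i) (C i)) :
    ChiSqBound (Measure.pi P) (Measure.pi Q) (∏ i, C i) := by
  induction n with
  | zero =>
    rw [Measure.pi_of_empty P, Measure.pi_of_empty Q, Fin.prod_univ_zero]
    exact refl _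
  | succ n ih =>
    have hP := (measurePreserving_piFinSuccAbove P 0).symm
    have hQ := (measurePreserving_piFinSuccAbove Q 0).symm
    rw [← hP.map_eq, ← hQ.map_eq, Fin.prod_univ_succ]
    exact ((h 0).prod (ih fun i => h i.succ)).map hP.measurable

theorem pi {ι : Type*} [Fintype ι] {X : ι → Type*} [∀ i, MeasurableSpace (X i)]
    {P Q : ∀ i, Measure (X i)} [∀ i, SigmaFinite (P i)] [∀ i, SigmaFinite (Q i)]
    {C : ι → ℝ≥0∞} (h : ∀ i, ChiSqBound (P i) (Q i) (C i)) :
    ChiSqBound (Measure.pi P) (Measure.pi Q) (∏ i, C i) := by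
  let e := (Fintype.equivFin ι).symm
  have hP := measurePreserving_piCongrLeft P e
  rw [← hP.map_eq, ← (measurePreserving_piCongrLeft Q e).map_eq, ← e.prod_comp]
  exact (pi_fin fun j => h (e j)).map hP.measurable

theorem measure_sq_le (h : ChiSqBound P Q C) {A : Set Ω} (hA : MeasurableSet A) :
    P A ^ 2 ≤ C * Q A := by
  have ind_sq : (fun x => A.indicator (1 : Ω → ℝ≥0∞) x ^ 2) = A.indicator 1 := by
    funext x
    by_cases hx : x ∈ A <;> simp [hx]
  simpa [ind_sq, lintegral_indicator_one hA] using h (A.indicator 1) (measurable_one.indicator hA)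

theorem inv_le_testing_error [IsProbabilityMeasure P] (h : ChiSqBound P Q C) (hC : 2 ≤ C)
    {A : Set Ω} (hA : MeasurableSet A) : C⁻¹ ≤ Q A + P Aᶜ := by
  have two_mul_le : 2 * P A ≤ 1 + P A ^ 2 := by
    rw [← ENNReal.toReal_le_toReal (by finiteness) (by finiteness)]
    simpa [ENNReal.toReal_add] using two_mul_le_add_sq 1 (P A).toReal
  have key : (1 : ℝ≥0∞) + 1 ≤ 1 + C * (Q A + P Aᶜ) := by
    calc (1 : ℝ≥0∞) + 1 = 2 * P A + 2 * P Aᶜ := by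
          rw [← mul_add, prob_add_prob_compl hA, one_add_one_eq_two, mul_one]
      _ ≤ (1 + C * Q A) + C * P Aᶜ := by
          gcongr
          exact two_mul_le.trans (by gcongr; exact h.measure_sq_le hA)
      _ = 1 + C * (Q A + P Aᶜ) := by ring
  rw [ENNReal.add_le_add_iff_left ENNReal.one_ne_top] at key
  exact (ENNReal.inv_le_iff_le_mul (fun _ => (two_pos.trans_le hC).ne')
    (by rintro - h0; simp [h0] at key)).2 key

end ChiSqBound

end ChiSqBound

section GaussianReal

open scoped NNReal

theorem gaussianPDFReal_sq (m : ℝ) {v w : ℝ≥0} (hv : 0 < v) (hvw : v < 2 * w) (x : ℝ) :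
    gaussianPDFReal m v x ^ 2 = gaussianPDFReal m w x *
      (w / √(v * (2 * w - v)) * gaussianPDFReal m (v * w / (2 * w - v)) x) := by
  have : (0 : ℝ) < v := hv
  have w_pos : (0 : ℝ) < w := by
    have : (v : ℝ) < 2 * w := hvw
    linarith
  have gap_pos : (0 : ℝ) < 2 * w - v := sub_pos.2 hvw
  have coe_var : ((v * w / (2 * w - v) : ℝ≥0) : ℝ) = v * w / (2 * w - v) := by
    push_cast [hvw.le]
    rfl
  have exp_sq : Real.exp (-(x - m) ^ 2 / (2 * v)) ^ 2 = Real.exp (-(x - m) ^ 2 / (2 * w)) *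
      Real.exp (-(x - m) ^ 2 / (2 * (v * w / (2 * w - v)))) := by
    rw [← Real.exp_nat_mul, ← Real.exp_add]
    congr 1
    field_simp
    push_cast
    ring
  have sqrt_mul_sqrt : √(2 * Real.pi * w) * √(2 * Real.pi * (v * w / (2 * w - v))) *
      √(v * (2 * w - v)) = 2 * Real.pi * v * w := by
    rw [← Real.sqrt_mul (by positivity), ← Real.sqrt_mul (by positivity),
      Real.sqrt_eq_iff_mul_self_eq (by positivity) (by positivity)]
    field_simp
  have normalization : (√(2 * Real.pi * v))⁻¹ ^ 2 = (√(2 * Real.pi * w))⁻¹ *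
      (w / √(v * (2 * w - v)) * (√(2 * Real.pi * (v * w / (2 * w - v))))⁻¹) := by
    rw [inv_pow, Real.sq_sqrt (by positivity)]
    have : 0 < √(2 * Real.pi * w) * √(2 * Real.pi * (v * w / (2 * w - v))) *
        √(v * (2 * w - v)) := by positivity
    calc (2 * Real.pi * v)⁻¹ = w / (2 * Real.pi * v * w) := by field_simp
      _ = _ := by rw [← sqrt_mul_sqrt]; simp only [div_eq_mul_inv, mul_inv]; ring
  simp only [gaussianPDFReal, coe_var]
  rw [mul_pow, exp_sq, normalization]
  ring

theorem chiSqBound_gaussianReal (m : ℝ) {v w : ℝ≥0} (hv : 0 < v) (hvw : v < 2 * w) :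
    ChiSqBound (gaussianReal m v) (gaussianReal m w)
      (ENNReal.ofReal (w / √(v * (2 * w - v)))) := by
  have w_pos : 0 < w := pos_of_mul_pos_right (hv.trans hvw) zero_le_two
  have integral_eq : ∫⁻ x, ENNReal.ofReal (w / √(v * (2 * w - v))) *
      gaussianPDF m (v * w / (2 * w - v)) x = ENNReal.ofReal (w / √(v * (2 * w - v))) := by
    have var_pos : 0 < v * w / (2 * w - v) := div_pos (mul_pos hv w_pos) (tsub_pos_of_lt hvw)
    rw [lintegral_const_mul _ (measurable_gaussianPDF _ _),
      lintegral_gaussianPDF_eq_one _ var_pos.ne', mul_one]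
  rw [gaussianReal_of_var_ne_zero m hv.ne', gaussianReal_of_var_ne_zero m w_pos.ne', ← integral_eq]
  refine chiSqBound_withDensity (measurable_gaussianPDF _ _) (measurable_gaussianPDF _ _)
    ((measurable_gaussianPDF _ _).const_mul _) fun x => ?_
  have pdf_nonneg := gaussianPDFReal_nonneg m
  rw [gaussianPDF, gaussianPDF, gaussianPDF, ← ENNReal.ofReal_mul (by positivity),
    ← ENNReal.ofReal_mul (pdf_nonneg _ _), ← ENNReal.ofReal_pow (pdf_nonneg _ _),
    gaussianPDFReal_sq m hv hvw]

theorem inv_sqrt_one_sub_le_exp {x : ℝ} (hx0 : 0 ≤ x) (hx : x ≤ 1 / 2) :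
    (√(1 - x))⁻¹ ≤ Real.exp x := by
  rw [← Real.sqrt_inv, Real.sqrt_le_left (Real.exp_nonneg _), ← Real.exp_nat_mul]
  calc (1 - x)⁻¹ ≤ 2 * x + 1 := by
        rw [inv_le_iff_one_le_mul₀ (by linarith)]
        nlinarith
    _ ≤ Real.exp (2 * x) := Real.add_one_le_exp _

theorem chiSqBound_gaussianReal_one (m : ℝ) {v : ℝ≥0} (hv : ((v : ℝ) - 1) ^ 2 ≤ 1 / 2) :
    ChiSqBound (gaussianReal m v) (gaussianReal m 1)
      (ENNReal.ofReal (Real.exp (((v : ℝ) - 1) ^ 2))) := by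
  have v_pos : (0 : ℝ) < v := by nlinarith
  have v_lt : (v : ℝ) < 2 * 1 := by nlinarith
  refine (chiSqBound_gaussianReal m (w := 1) v_pos v_lt).mono (ENNReal.ofReal_le_ofReal ?_)
  convert inv_sqrt_one_sub_le_exp (sq_nonneg _) hv using 1
  rw [NNReal.coe_one, one_div]
  ring_nf

end GaussianReal

section MultivariateGaussian

open Matrix
open scoped NNReal

variable {ι : Type*} [Fintype ι] [DecidableEq ι]

theorem toLp_map_pi_gaussianReal (m : ι → ℝ) (v : ι → ℝ≥0) :
    (Measure.pi fun i => gaussianReal (m i) (v i)).map (WithLp.toLp 2) =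
      multivariateGaussian (WithLp.toLp 2 m) (diagonal fun i => (v i : ℝ)) := by
  refine Measure.ext_of_charFun (E := EuclideanSpace ℝ ι) (funext fun t => ?_)
  rw [charFun_multivariateGaussian (PosSemidef.diagonal fun i => (v i).coe_nonneg), charFun_pi]
  simp only [charFun_gaussianReal, ← Complex.exp_sum, Finset.sum_sub_distrib,
    EuclideanSpace.inner_eq_star_dotProduct, dotProduct, mulVec_diagonal, star_trivial]
  push_cast
  simp only [Finset.sum_mul, Finset.sum_div]
  congr! 3 with i - i
  · ring
  · ring

theorem toEuclideanCLM_map_multivariateGaussian (T : Matrix ι ι ℝ) (μ : EuclideanSpace ℝ ι)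
    {S : Matrix ι ι ℝ} (hS : S.PosSemidef) :
    (multivariateGaussian μ S).map (toEuclideanCLM (𝕜 := ℝ) T) =
      multivariateGaussian (toEuclideanCLM (𝕜 := ℝ) T μ) (T * S * Tᵀ) := by
  have hTS : (T * S * Tᵀ).PosSemidef := by simpa using hS.mul_mul_conjTranspose_same T
  refine IsGaussian.ext ?_ ?_
  · simp only [id_eq, integral_id_multivariateGaussian]
    rw [ContinuousLinearMap.integral_id_map IsGaussian.integrable_id,
      integral_id_multivariateGaussian]
  · ext x y
    have adjoint_apply (z : EuclideanSpace ℝ ι) :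
        ((toEuclideanCLM (𝕜 := ℝ) T).adjoint z).ofLp = Tᵀ *ᵥ z.ofLp := by
      rw [← ContinuousLinearMap.star_eq_adjoint, ← map_star, ofLp_toEuclideanCLM,
        star_eq_conjTranspose, conjTranspose_eq_transpose_of_trivial]
    rw [covarianceBilin_map IsGaussian.memLp_two_id, covarianceBilin_multivariateGaussian hS,
      covarianceBilin_multivariateGaussian hTS, adjoint_apply, adjoint_apply, mulVec_transpose,
      ← dotProduct_mulVec, mulVec_mulVec, mulVec_mulVec, Matrix.mul_assoc]

end MultivariateGaussian

section SimultaneousDiagonalization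

open Matrix
open scoped MatrixOrder ComplexOrder

variable {ι : Type*} [Fintype ι]

theorem exists_simultaneous_diagonalization {𝕜 : Type*} [RCLike 𝕜] [DecidableEq ι]
    {S S' : Matrix ι ι 𝕜} (hS : S.PosDef) (hS' : S'.IsHermitian) :
    ∃ (T : Matrix ι ι 𝕜) (d : ι → ℝ), IsUnit T ∧ S = T * Tᴴ ∧
      S' = T * diagonal (RCLike.ofReal ∘ d) * Tᴴ := by
  obtain ⟨R, hRH, hRS, hR⟩ : ∃ R : Matrix ι ι 𝕜, Rᴴ = R ∧ R * R = S ∧ IsUnit R := by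
    have sqrt_mul_sqrt := CFC.sqrt_mul_sqrt_self S hS.posSemidef.nonneg
    exact ⟨CFC.sqrt S, (CFC.sqrt_nonneg S).isSelfAdjoint.star_eq, sqrt_mul_sqrt,
      isUnit_of_mul_isUnit_left (sqrt_mul_sqrt ▸ hS.isUnit)⟩
  have det_R : IsUnit R.det := (isUnit_iff_isUnit_det R).1 hR
  have whitened : (R⁻¹ * S' * R⁻¹).IsHermitian := by
    simpa only [conjTranspose_nonsing_inv, hRH] using isHermitian_conjTranspose_mul_mul R⁻¹ hS'
  let U := whitened.eigenvectorUnitary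
  let D : Matrix ι ι 𝕜 := diagonal (RCLike.ofReal ∘ whitened.eigenvalues)
  have spectral : R⁻¹ * S' * R⁻¹ = U.1 * D * U.1ᴴ := by
    simpa only [Unitary.conjStarAlgAut_apply] using! whitened.spectral_theorem
  refine ⟨R * U.1, whitened.eigenvalues, hR.mul (Unitary.isUnit_coe (U := U)), ?_, ?_⟩
  · calc S = R * (U.1 * U.1ᴴ) * R := by
          rw [← star_eq_conjTranspose, Unitary.mul_star_self_of_mem U.2, Matrix.mul_one, hRS]
      _ = R * U.1 * (R * U.1)ᴴ := by simp only [conjTranspose_mul, hRH, Matrix.mul_assoc]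
  · calc S' = R * (R⁻¹ * S' * R⁻¹) * R := by
          rw [Matrix.mul_assoc R⁻¹, mul_nonsing_inv_cancel_left _ _ det_R,
            nonsing_inv_mul_cancel_right _ _ det_R]
      _ = R * U.1 * D * (R * U.1)ᴴ := by
          simp only [spectral, conjTranspose_mul, hRH, Matrix.mul_assoc]

theorem trace_mul_self_le_trace_transpose_mul (M : Matrix ι ι ℝ) :
    (M * M).trace ≤ (Mᵀ * M).trace := by
  have gap_nonneg := (posSemidef_conjTranspose_mul_self (M - Mᵀ)).trace_nonneg
  simp only [conjTranspose_eq_transpose_of_trivial, transpose_sub, transpose_transpose,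
    Matrix.sub_mul, Matrix.mul_sub, trace_sub] at gap_nonneg
  have : (Mᵀ * Mᵀ).trace = (M * M).trace := by rw [← transpose_mul, trace_transpose]
  have : (M * Mᵀ).trace = (Mᵀ * M).trace := trace_mul_comm _ _
  linarith

variable [DecidableEq ι]

theorem sq_mul_trace_le_trace_transpose_mul {S : Matrix ι ι ℝ} {a : ℝ} (ha : 0 ≤ a)
    (hS : (S - a • (1 : Matrix ι ι ℝ)).PosSemidef) (M : Matrix ι ι ℝ) :
    a ^ 2 * (Mᵀ * M).trace ≤ ((S * M)ᵀ * (S * M)).trace := by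
  set E := S - a • (1 : Matrix ι ι ℝ) with hE
  have S_eq : S = E + a • 1 := by rw [hE, sub_add_cancel]
  have E_symm : Eᵀ = E := by simpa using hS.isHermitian.eq
  have gram_eq : (S * M)ᵀ * (S * M) =
      (E * M)ᴴ * (E * M) + (2 * a) • (Mᴴ * E * M) + a ^ 2 • (Mᵀ * M) := by
    simp only [S_eq, conjTranspose_eq_transpose_of_trivial, transpose_mul, transpose_add, E_symm,
      transpose_smul, Matrix.add_mul, Matrix.mul_add, Matrix.smul_mul,
      Matrix.mul_smul, Matrix.one_mul, Matrix.mul_assoc]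
    module
  have sq_nonneg := (posSemidef_conjTranspose_mul_self (E * M)).trace_nonneg
  have cross_nonneg := ((hS.conjTranspose_mul_mul_same M).smul
    (mul_nonneg zero_le_two ha)).trace_nonneg
  rw [gram_eq, trace_add, trace_add, trace_smul (a ^ 2), smul_eq_mul]
  linarith

theorem exists_diagonalization_sq_mul_sum_le {S S' : Matrix ι ι ℝ} {a : ℝ} (ha : 0 < a)
    (hS : (S - a • (1 : Matrix ι ι ℝ)).PosSemidef) (hS' : S'.IsHermitian) :
    ∃ (T : Matrix ι ι ℝ) (d : ι → ℝ), IsUnit T ∧ S = T * Tᵀ ∧ S' = T * diagonal d * Tᵀ ∧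
      a ^ 2 * ∑ i, (d i - 1) ^ 2 ≤ ((S' - S) ^ 2).trace := by
  have S_posDef : S.PosDef := by
    simpa using PosDef.posSemidef_add hS (PosDef.one.smul ha)
  obtain ⟨T, d, hT, hTS, hTS'⟩ := exists_simultaneous_diagonalization S_posDef hS'
  rw [conjTranspose_eq_transpose_of_trivial] at hTS hTS'
  refine ⟨T, d, hT, hTS, hTS', ?_⟩
  have cancel : Tᵀ * T⁻¹ᵀ = 1 := by
    rw [← transpose_mul, nonsing_inv_mul _ ((isUnit_iff_isUnit_det T).1 hT), transpose_one]
  -- `M` is the inverse of `S` times `S' - S`, and it is similar to `diagonal d - 1`.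
  set M := T⁻¹ᵀ * (diagonal d - 1) * Tᵀ with hM
  have S_mul_M : S * M = S' - S := by
    calc S * M = T * (Tᵀ * T⁻¹ᵀ) * (diagonal d - 1) * Tᵀ := by simp only [hTS, hM, Matrix.mul_assoc]
      _ = S' - S := by
        rw [cancel, hTS', hTS, Matrix.mul_one, Matrix.mul_sub, Matrix.sub_mul, Matrix.mul_one]
        rfl
  have trace_M_sq : (M * M).trace = ∑ i, (d i - 1) ^ 2 := by
    calc (M * M).trace
        = ((diagonal d - 1) * (Tᵀ * T⁻¹ᵀ) * (diagonal d - 1) * (Tᵀ * T⁻¹ᵀ)).trace := by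
          rw [← Matrix.mul_assoc _ Tᵀ, trace_mul_comm _ T⁻¹ᵀ]
          simp only [hM, Matrix.mul_assoc]
      _ = ∑ i, (d i - 1) ^ 2 := by
          rw [cancel, Matrix.mul_one, Matrix.mul_one, ← diagonal_one, diagonal_sub,
            diagonal_mul_diagonal, trace_diagonal]
          simp only [sq]
  have diff_symm : (S' - S)ᵀ = S' - S := by
    simpa using (hS'.sub S_posDef.isHermitian).eq
  calc a ^ 2 * ∑ i, (d i - 1) ^ 2 ≤ a ^ 2 * (Mᵀ * M).trace := by
        rw [← trace_M_sq]
        gcongr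
        exact trace_mul_self_le_trace_transpose_mul M
    _ ≤ ((S * M)ᵀ * (S * M)).trace := sq_mul_trace_le_trace_transpose_mul ha.le hS M
    _ = ((S' - S) ^ 2).trace := by rw [S_mul_M, diff_symm, sq]

end SimultaneousDiagonalization

section QuantizedGaussian

open Matrix

theorem chiSqBound_multivariateGaussian {ι : Type*} [Fintype ι] [DecidableEq ι]
    (μ : EuclideanSpace ℝ ι) {S S' : Matrix ι ι ℝ} {a : ℝ} (ha : 0 < a)
    (hS : (S - a • (1 : Matrix ι ι ℝ)).PosSemidef) (hS' : S'.IsHermitian)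
    (htr : ((S' - S) ^ 2).trace ≤ a ^ 2 / 2) :
    ChiSqBound (multivariateGaussian μ S') (multivariateGaussian μ S)
      (ENNReal.ofReal (Real.exp (((S' - S) ^ 2).trace / a ^ 2))) := by
  obtain ⟨T, d, hT, hTS, hTS', d_le⟩ := exists_diagonalization_sq_mul_sum_le ha hS hS'
  rw [← le_div_iff₀' (by positivity)] at d_le
  have d_near_one (i : ι) : (d i - 1) ^ 2 ≤ 1 / 2 := by
    calc (d i - 1) ^ 2 ≤ ∑ j, (d j - 1) ^ 2 :=
          Finset.single_le_sum (f := fun j => (d j - 1) ^ 2) (fun j _ => sq_nonneg _)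
            (Finset.mem_univ i)
      _ ≤ ((S' - S) ^ 2).trace / a ^ 2 := d_le
      _ ≤ 1 / 2 := by rwa [div_le_iff₀ (by positivity), one_div_mul_eq_div]
  lift d to ι → NNReal using fun i => by nlinarith [d_near_one i]
  obtain ⟨m, hm⟩ : ∃ m : ι → ℝ, toEuclideanCLM (𝕜 := ℝ) T (WithLp.toLp 2 m) = μ :=
    ⟨T⁻¹ *ᵥ μ.ofLp, by
      rw [toEuclideanCLM_toLp, mulVec_mulVec, mul_nonsing_inv _ ((isUnit_iff_isUnit_det T).1 hT),
        one_mulVec]⟩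
  have map_eq (v : ι → NNReal) :
      ((Measure.pi fun i => gaussianReal (m i) (v i)).map (WithLp.toLp 2)).map
        (toEuclideanCLM (𝕜 := ℝ) T) =
      multivariateGaussian μ (T * diagonal (fun i => (v i : ℝ)) * Tᵀ) := by
    rw [toLp_map_pi_gaussianReal, toEuclideanCLM_map_multivariateGaussian _ _
      (PosSemidef.diagonal fun i => (v i).coe_nonneg), hm]
  have S_eq : S = T * diagonal (fun _ => ((1 : NNReal) : ℝ)) * Tᵀ := by simpa using hTS
  have bound := ((ChiSqBound.pi fun i => chiSqBound_gaussianReal_one (m i) (d_near_one i)).map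
    (WithLp.measurable_toLp 2 _)).map (toEuclideanCLM (𝕜 := ℝ) T).measurable
  rw [map_eq, map_eq, ← hTS', ← S_eq,
    ← ENNReal.ofReal_prod_of_nonneg fun _ _ => Real.exp_nonneg _, ← Real.exp_sum] at bound
  exact bound.mono (by gcongr)

theorem chiSqBound_quantizedLaw {p : ℕ} {lam : ℝ} (hl : 0 < lam)
    {S S' : Matrix (Fin p) (Fin p) ℝ} {C : ℝ≥0∞}
    (h : ChiSqBound (multivariateGaussian 0 S') (multivariateGaussian 0 S) C) :
    ChiSqBound (quantizedLaw lam S') (quantizedLaw lam S) C := by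
  have := isProbabilityMeasure_ditherLaw p hl
  simpa [quantizedLaw] using
    (h.prod (ChiSqBound.refl (ditherLaw p lam))).map (measurable_quantize p)

theorem chiSqBound_sampleLaw {p : ℕ} (n : ℕ) {lam : ℝ} (hl : 0 < lam)
    {S S' : Matrix (Fin p) (Fin p) ℝ} {C : ℝ≥0∞}
    (h : ChiSqBound (multivariateGaussian 0 S') (multivariateGaussian 0 S) C) :
    ChiSqBound (sampleLaw n lam S') (sampleLaw n lam S) (C ^ n) := by
  have := isProbabilityMeasure_quantizedLaw hl S
  have := isProbabilityMeasure_quantizedLaw hl S'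
  simpa [sampleLaw] using ChiSqBound.pi fun _ : Fin n => chiSqBound_quantizedLaw hl h

theorem ofReal_exp_neg_two_le_testing_error {n p : ℕ} {lam : ℝ} (hl : 0 < lam)
    {S S' : Matrix (Fin p) (Fin p) ℝ} {a : ℝ} (ha : 0 < a)
    (hS : (S - a • (1 : Matrix (Fin p) (Fin p) ℝ)).PosSemidef) (hS' : S'.IsHermitian)
    (htr : ((S' - S) ^ 2).trace ≤ a ^ 2 / 2) (hntr : n * ((S' - S) ^ 2).trace ≤ 2 * a ^ 2)
    (A : Set (Fin n → Fin p → ℤˣ)) :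
    ENNReal.ofReal (Real.exp (-2)) ≤ sampleLaw n lam S A + sampleLaw n lam S' Aᶜ := by
  have := isProbabilityMeasure_quantizedLaw hl S'
  have : IsProbabilityMeasure (sampleLaw n lam S') := by unfold sampleLaw; infer_instance
  have bound := chiSqBound_sampleLaw n hl (chiSqBound_multivariateGaussian 0 ha hS hS' htr)
  rw [← ENNReal.ofReal_pow (Real.exp_nonneg _), ← Real.exp_nat_mul, ← mul_div_assoc] at bound
  have exp_le : ENNReal.ofReal (Real.exp (n * ((S' - S) ^ 2).trace / a ^ 2)) ≤
      ENNReal.ofReal (Real.exp 2) := by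
    gcongr
    rwa [div_le_iff₀ (by positivity)]
  have two_le : 2 ≤ ENNReal.ofReal (Real.exp 2) := by
    rw [← ENNReal.ofReal_ofNat]
    gcongr
    linarith [Real.add_one_le_exp 2]
  simpa only [Real.exp_neg, ENNReal.ofReal_inv_of_pos (Real.exp_pos 2)] using
    (bound.mono exp_le).inv_le_testing_error two_le (.of_discrete (s := A))

end QuantizedGaussian

section Assouad

variable {ι Ω : Type*} [Fintype ι] [MeasurableSpace Ω]

theorem lintegral_hammingDist (μ : Measure Ω) {d : Ω → ι → Fin 2} (hd : Measurable d)
    (θ : ι → Fin 2) :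
    ∫⁻ ω, hammingDist (d ω) θ ∂μ = ∑ k, μ {ω | d ω k ≠ θ k} := by
  have hmeas (k : ι) : MeasurableSet {ω | d ω k ≠ θ k} :=
    (measurableSet_singleton (θ k)).compl.preimage (hd.eval (a := k))
  have dist_eq (ω : Ω) : (hammingDist (d ω) θ : ℝ≥0∞) =
      ∑ k, {ω | d ω k ≠ θ k}.indicator 1 ω := by
    rw [hammingDist, Finset.natCast_card_filter]
    simp only [Set.indicator_apply, Set.mem_ofPred_eq, Pi.one_apply]
  simp only [dist_eq]
  rw [lintegral_finsetSum _ fun k _ => measurable_one.indicator (hmeas k)]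
  simp only [lintegral_indicator_one (hmeas _)]

variable [DecidableEq ι]

theorem card_mul_le_two_mul_iSup_sum_of_flip {c : ℝ≥0∞} (e : (ι → Fin 2) → ι → ℝ≥0∞)
    (h : ∀ θ k, c ≤ e θ k + e (θ + Pi.single k 1) k) :
    Fintype.card ι * c ≤ 2 * ⨆ θ, ∑ k, e θ k := by
  set N : ℝ≥0∞ := (Fintype.card (ι → Fin 2) : ℝ≥0∞) with hN
  have sum_flip (k : ι) : ∑ θ, e (θ + Pi.single k 1) k = ∑ θ, e θ k :=
    Fintype.sum_equiv (Equiv.addRight (Pi.single k 1)) _ _ fun _ => rfl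
  refine (ENNReal.mul_le_mul_iff_right (a := N) (by simp [hN]) (ENNReal.natCast_ne_top _)).1 ?_
  calc N * (Fintype.card ι * c) = ∑ _k : ι, ∑ _θ : ι → Fin 2, c := by
        simp only [Finset.sum_const, Finset.card_univ, nsmul_eq_mul, ← hN]
        ring
    _ ≤ ∑ k, ∑ θ, (e θ k + e (θ + Pi.single k 1) k) := by
        gcongr with k _ θ
        exact h θ k
    _ = 2 * ∑ θ, ∑ k, e θ k := by
        simp only [Finset.sum_add_distrib, sum_flip, ← two_mul]
        rw [Finset.sum_comm, Finset.mul_sum]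
    _ ≤ 2 * ∑ _θ : ι → Fin 2, ⨆ θ, ∑ k, e θ k := by
        gcongr with θ
        exact le_iSup (fun θ => ∑ k, e θ k) θ
    _ = N * (2 * ⨆ θ, ∑ k, e θ k) := by
        rw [Finset.sum_const, Finset.card_univ, nsmul_eq_mul, ← hN, mul_left_comm]

theorem assouad (P : (ι → Fin 2) → Measure Ω) {d : Ω → ι → Fin 2} (hd : Measurable d)
    {L : (ι → Fin 2) → Ω → ℝ≥0∞} {c δ : ℝ≥0∞}
    (htest : ∀ θ k, ∀ A, MeasurableSet A → c ≤ P θ A + P (θ + Pi.single k 1) Aᶜ)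
    (hloss : ∀ θ ω, δ * hammingDist (d ω) θ ≤ L θ ω) :
    δ * (Fintype.card ι * c) ≤ 2 * ⨆ θ, ∫⁻ ω, L θ ω ∂P θ := by
  have flip_bound (θ : ι → Fin 2) (k : ι) : c ≤ P θ {ω | d ω k ≠ θ k} +
      P (θ + Pi.single k 1) {ω | d ω k ≠ (θ + Pi.single k 1 : ι → Fin 2) k} := by
    have ne_flip_iff (a b : Fin 2) : a ≠ b + 1 ↔ ¬ a ≠ b := by decide +revert
    simpa only [Pi.add_apply, Pi.single_eq_same, ne_flip_iff, Set.compl_ofPred] using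
      htest θ k {ω | d ω k ≠ θ k} <|
        (measurableSet_singleton (θ k)).compl.preimage (hd.eval (a := k))
  calc δ * (Fintype.card ι * c)
      ≤ δ * (2 * ⨆ θ, ∑ k, P θ {ω | d ω k ≠ θ k}) := by
        gcongr δ * ?_
        exact card_mul_le_two_mul_iSup_sum_of_flip _ flip_bound
    _ = 2 * ⨆ θ, δ * ∫⁻ ω, hammingDist (d ω) θ ∂P θ := by
        simp only [lintegral_hammingDist _ hd, ← ENNReal.mul_iSup, mul_left_comm δ]
    _ ≤ 2 * ⨆ θ, ∫⁻ ω, L θ ω ∂P θ := by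
        gcongr with θ
        exact (lintegral_const_mul_le δ _).trans (lintegral_mono (hloss θ))

end Assouad

section PerturbedIdentity

open Matrix

theorem posSemidef_card_smul_one_add {ι : Type*} [Fintype ι] [DecidableEq ι] {A : Matrix ι ι ℝ}
    (hA : A.IsHermitian) (hA1 : ∀ i j, |A i j| ≤ 1) :
    ((Fintype.card ι : ℝ) • (1 : Matrix ι ι ℝ) + A).PosSemidef := by
  refine .of_dotProduct_mulVec_nonneg
    ((isHermitian_one.smul (IsSelfAdjoint.all _)).add hA) fun x => ?_
  have card_mul_sq : (Fintype.card ι : ℝ) * (x ⬝ᵥ x) = ∑ i, ∑ j, (x i ^ 2 + x j ^ 2) / 2 := by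
    simp_rw [← Finset.sum_div, Finset.sum_add_distrib, Finset.sum_const, Finset.card_univ,
      nsmul_eq_mul, ← Finset.mul_sum, dotProduct, ← sq]
    ring
  have quad_form : x ⬝ᵥ A *ᵥ x = ∑ i, ∑ j, A i j * (x i * x j) := by
    simp only [dotProduct, mulVec, Finset.mul_sum]
    exact Finset.sum_congr rfl fun i _ => Finset.sum_congr rfl fun j _ => by ring
  rw [star_trivial, add_mulVec, smul_mulVec, one_mulVec, dotProduct_add, dotProduct_smul,
    smul_eq_mul, card_mul_sq, quad_form, ← Finset.sum_add_distrib]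
  refine Finset.sum_nonneg fun i _ => ?_
  rw [← Finset.sum_add_distrib]
  refine Finset.sum_nonneg fun j _ => ?_
  obtain ⟨neg_one_le, le_one⟩ := abs_le.1 (hA1 i j)
  nlinarith [mul_nonneg (neg_le_iff_add_nonneg.1 neg_one_le) (sq_nonneg (x i + x j)),
    mul_nonneg (sub_nonneg.2 le_one) (sq_nonneg (x i - x j))]

theorem isHermitian_rowColMatrix (p k : ℕ) : (rowColMatrix p k).IsHermitian := by
  ext i j
  simp [rowColMatrix, or_comm]

theorem rowColMatrix_apply_self (p k : ℕ) (i : Fin p) : rowColMatrix p k i i = 0 := by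
  simp only [rowColMatrix, of_apply, ite_eq_right_iff]
  omega

theorem rowColMatrix_apply_of_lt {p : ℕ} (k : ℕ) {i j : Fin p} (hij : i < j) :
    rowColMatrix p k i j = if (i : ℕ) = k then 1 else 0 := by
  simp only [rowColMatrix, of_apply]
  congr 1
  rw [eq_iff_iff]
  omega

theorem trace_rowColMatrix_sq {p : ℕ} (k : Fin p) :
    (rowColMatrix p k ^ 2).trace = 2 * ((p : ℝ) - 1 - k) := by
  have entry_sq (i j : Fin p) : rowColMatrix p k i j * rowColMatrix p k j i =
      (if i = k then if k < j then 1 else 0 else 0) +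
        if j = k then if k < i then 1 else 0 else 0 := by
    simp only [rowColMatrix, of_apply, Fin.ext_iff, Fin.lt_def]
    split_ifs <;> first | omega | norm_num
  have card_Ioi : ∑ j, (if k < j then (1 : ℝ) else 0) = p - 1 - k := by
    rw [Finset.sum_boole, Finset.filter_lt_eq_Ioi, Fin.card_Ioi, Nat.sub_sub, Nat.cast_sub (by lia)]
    push_cast
    ring
  simp only [sq, trace, diag_apply, mul_apply, entry_sq, Finset.sum_add_distrib]
  rw [Finset.sum_comm]
  simp only [Finset.sum_ite_eq', Finset.mem_univ, if_true, card_Ioi]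
  ring

/-- The weight `1 / (2 √(n p))` of the perturbation in `perturbedId n p θ`. -/
noncomputable def perturbationScale (n p : ℕ) : ℝ := 1 / (2 * √((n : ℝ) * (p : ℝ)))

/-- The direction `∑ k, θ k • M k` in which `perturbedId n p θ` departs from the identity. -/
noncomputable def perturbation (p : ℕ) (θ : Fin (p / 2) → Fin 2) : Matrix (Fin p) (Fin p) ℝ :=
  ∑ k, ((θ k : ℕ) : ℝ) • rowColMatrix p k

theorem perturbationScale_nonneg (n p : ℕ) : 0 ≤ perturbationScale n p := by
  unfold perturbationScale
  positivity

theorem perturbationScale_sq (n p : ℕ) : perturbationScale n p ^ 2 = 1 / (4 * (n * p)) := by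
  rw [perturbationScale, div_pow, mul_pow, Real.sq_sqrt (by positivity)]
  norm_num

theorem perturbationScale_mul_le_half {n p : ℕ} (hpn : p ≤ n) :
    perturbationScale n p * p ≤ 1 / 2 := by
  rcases p.eq_zero_or_pos with rfl | hp
  · simp
  have scale_nonneg := perturbationScale_nonneg n p
  refine (sq_le_sq₀ (by positivity) (by norm_num)).1 ?_
  rw [mul_pow, perturbationScale_sq]
  have : (p : ℝ) ≤ n := mod_cast hpn
  have : (0 : ℝ) < n := mod_cast hp.trans_le hpn
  field_simp
  norm_num
  linarith

theorem perturbedId_eq (n p : ℕ) (θ : Fin (p / 2) → Fin 2) :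
    perturbedId n p θ = 1 + perturbationScale n p • perturbation p θ := rfl

theorem isHermitian_perturbation (p : ℕ) (θ : Fin (p / 2) → Fin 2) :
    (perturbation p θ).IsHermitian :=
  isSelfAdjoint_sum (R := Matrix (Fin p) (Fin p) ℝ) _ fun k _ =>
    (isHermitian_rowColMatrix p k).smul (IsSelfAdjoint.all _)

theorem isHermitian_perturbedId (n p : ℕ) (θ : Fin (p / 2) → Fin 2) :
    (perturbedId n p θ).IsHermitian :=
  isHermitian_one.add ((isHermitian_perturbation p θ).smul (IsSelfAdjoint.all _))

theorem perturbation_apply_of_lt {p : ℕ} (θ : Fin (p / 2) → Fin 2) {i j : Fin p} (hij : i < j) :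
    perturbation p θ i j = if h : (i : ℕ) < p / 2 then ((θ ⟨i, h⟩ : ℕ) : ℝ) else 0 := by
  simp only [perturbation, Matrix.sum_apply, Matrix.smul_apply, rowColMatrix_apply_of_lt _ hij,
    smul_eq_mul, mul_ite, mul_one, mul_zero]
  split_ifs with h
  · rw [Finset.sum_eq_single ⟨i, h⟩
      (fun k _ hk => if_neg fun hik => hk (Fin.ext hik.symm)) (by simp), if_pos rfl]
  · exact Finset.sum_eq_zero fun k _ => if_neg (by lia)

theorem abs_perturbation_apply_le_one {p : ℕ} (θ : Fin (p / 2) → Fin 2) (i j : Fin p) :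
    |perturbation p θ i j| ≤ 1 := by
  wlog hij : i ≤ j generalizing i j
  · rw [← (isHermitian_perturbation p θ).apply]
    simpa using this j i (le_of_not_ge hij)
  rcases hij.eq_or_lt with rfl | hlt
  · simp [perturbation, Matrix.sum_apply, rowColMatrix_apply_self]
  rw [perturbation_apply_of_lt θ hlt]
  split_ifs
  · rw [Nat.abs_cast]
    exact mod_cast Fin.is_le _
  · simp

theorem posSemidef_perturbedId_sub_half {n p : ℕ} (hpn : p ≤ n) (θ : Fin (p / 2) → Fin 2) :
    (perturbedId n p θ - (1 / 2 : ℝ) • (1 : Matrix (Fin p) (Fin p) ℝ)).PosSemidef := by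
  have decomposition : perturbedId n p θ - (1 / 2 : ℝ) • (1 : Matrix (Fin p) (Fin p) ℝ) =
      (1 / 2 - perturbationScale n p * p) • (1 : Matrix (Fin p) (Fin p) ℝ) +
        perturbationScale n p • ((Fintype.card (Fin p) : ℝ) • 1 + perturbation p θ) := by
    rw [perturbedId_eq, Fintype.card_fin]
    module
  rw [decomposition]
  exact (PosSemidef.one.smul (sub_nonneg.2 (perturbationScale_mul_le_half hpn))).add <|
    (posSemidef_card_smul_one_add (isHermitian_perturbation p θ)
      (abs_perturbation_apply_le_one θ)).smul (perturbationScale_nonneg n p)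

theorem perturbation_add_single_sub_sq {p : ℕ} (θ : Fin (p / 2) → Fin 2) (k : Fin (p / 2)) :
    (perturbation p (θ + Pi.single k 1) - perturbation p θ) ^ 2 = rowColMatrix p k ^ 2 := by
  have diff_eq : perturbation p (θ + Pi.single k 1) - perturbation p θ =
      ((((θ k + 1 : Fin 2) : ℕ) : ℝ) - ((θ k : ℕ) : ℝ)) • rowColMatrix p k := by
    rw [perturbation, perturbation, ← Finset.sum_sub_distrib,
      Finset.sum_eq_single k (fun l _ hl => by simp [hl]) (by simp), sub_smul]
    simp
  have flip_sq (b : Fin 2) : ((((b + 1 : Fin 2) : ℕ) : ℝ) - ((b : ℕ) : ℝ)) ^ 2 = 1 := by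
    fin_cases b <;> simp
  rw [diff_eq, smul_pow, flip_sq, one_smul]

theorem trace_perturbedId_sub_sq_le (n : ℕ) {p : ℕ} (θ : Fin (p / 2) → Fin 2)
    (k : Fin (p / 2)) :
    ((perturbedId n p (θ + Pi.single k 1) - perturbedId n p θ) ^ 2).trace ≤
      (p - 1) / (2 * (n * p)) := by
  rw [perturbedId_eq, perturbedId_eq, add_sub_add_left_eq_sub, ← smul_sub, smul_pow,
    perturbation_add_single_sub_sq, trace_smul, perturbationScale_sq, smul_eq_mul]
  have trace_le : (rowColMatrix p k ^ 2).trace ≤ 2 * ((p : ℝ) - 1) := by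
    rw [← Fin.val_castLE (Nat.div_le_self p 2) k, trace_rowColMatrix_sq]
    have : (0 : ℝ) ≤ (k.castLE (Nat.div_le_self p 2) : ℕ) := Nat.cast_nonneg _
    linarith
  calc 1 / (4 * ((n : ℝ) * p)) * (rowColMatrix p k ^ 2).trace
      ≤ 1 / (4 * (n * p)) * (2 * (p - 1)) := by gcongr
    _ = (p - 1) / (2 * (n * p)) := by ring

theorem ofReal_exp_neg_two_le_testing_error_perturbedId {n p : ℕ} (hpn : p ≤ n) {lam : ℝ}
    (hl : 0 < lam) (θ : Fin (p / 2) → Fin 2) (k : Fin (p / 2)) (A : Set (Fin n → Fin p → ℤˣ)) :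
    ENNReal.ofReal (Real.exp (-2)) ≤ sampleLaw n lam (perturbedId n p θ) A +
      sampleLaw n lam (perturbedId n p (θ + Pi.single k 1)) Aᶜ := by
  have hp : 0 < p := by have := k.2; lia
  have hn : 0 < n := hp.trans_le hpn
  have hpn' : (p : ℝ) ≤ n := mod_cast hpn
  have trace_le := trace_perturbedId_sub_sq_le n θ k
  refine ofReal_exp_neg_two_le_testing_error hl one_half_pos (posSemidef_perturbedId_sub_half hpn θ)
    (isHermitian_perturbedId n p _) (trace_le.trans ?_) ?_ A
  · calc ((p : ℝ) - 1) / (2 * (n * p)) ≤ (p ^ 2 / 4) / (2 * (p * p)) := by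
          gcongr
          linarith [sq_nonneg ((p : ℝ) - 2)]
      _ = (1 / 2) ^ 2 / 2 := by field_simp; norm_num
  · calc (n : ℝ) * _ ≤ n * ((p - 1) / (2 * (n * p))) := by gcongr
      _ ≤ n * (p / (2 * (n * p))) := by gcongr; linarith
      _ = 2 * (1 / 2) ^ 2 := by field_simp

end PerturbedIdentity

section Separation

open Matrix

/-- The indicator vector of the coordinates `j ≥ p / 2`. Applied to it, a perturbed identity matrix
with parameter `θ` displays the bits of `θ` in the first `p / 2` coordinates. -/
def upperHalf (p : ℕ) : Fin p → ℝ := fun j => if p / 2 ≤ (j : ℕ) then 1 else 0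

theorem sum_upperHalf (p : ℕ) : ∑ j, upperHalf p j = ((p - p / 2 : ℕ) : ℝ) := by
  simp only [upperHalf, Finset.sum_boole, ← not_lt]
  rw [← Finset.compl_filter, Finset.card_compl, Fin.card_filter_val_lt, Fintype.card_fin,
    min_eq_right (p.div_le_self 2)]

theorem sum_upperHalf_sq (p : ℕ) : ∑ j, upperHalf p j ^ 2 = ((p - p / 2 : ℕ) : ℝ) := by
  simp only [← sum_upperHalf, upperHalf, ite_pow, one_pow, ne_eq, two_ne_zero, not_false_eq_true,
    zero_pow]

theorem perturbedId_mulVec_upperHalf (n : ℕ) {p : ℕ} (θ : Fin (p / 2) → Fin 2)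
    (k : Fin (p / 2)) :
    (perturbedId n p θ *ᵥ upperHalf p) (k.castLE (p.div_le_self 2)) =
      perturbationScale n p * ((p - p / 2 : ℕ) : ℝ) * ((θ k : ℕ) : ℝ) := by
  have entry_mul (j : Fin p) :
      perturbedId n p θ (k.castLE (p.div_le_self 2)) j * upperHalf p j =
        perturbationScale n p * ((θ k : ℕ) : ℝ) * upperHalf p j := by
    rcases lt_or_ge (j : ℕ) (p / 2) with hj | hj
    · simp [upperHalf, hj.not_ge]
    have hkj : k.castLE (p.div_le_self 2) < j := k.2.trans_le hj
    rw [perturbedId_eq, Matrix.add_apply, Matrix.smul_apply, one_apply_ne hkj.ne,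
      perturbation_apply_of_lt θ hkj, dif_pos (by exact k.2), zero_add, smul_eq_mul]
    rfl
  simp only [mulVec, dotProduct, entry_mul, ← Finset.mul_sum, sum_upperHalf]
  ring

/-- The parameter in the cube read off from an estimate `B` of a perturbed identity matrix, by
thresholding the first `p / 2` coordinates of `B *ᵥ upperHalf p` halfway between the values they
take for `θ k = 0` and `θ k = 1`. -/
noncomputable def decode (n p : ℕ) (B : Matrix (Fin p) (Fin p) ℝ) (k : Fin (p / 2)) : Fin 2 :=
  if (B *ᵥ upperHalf p) (k.castLE (p.div_le_self 2)) <
    perturbationScale n p * ((p - p / 2 : ℕ) : ℝ) / 2 then 0 else 1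

theorem sq_le_mulVec_sq_of_decode_ne {n p : ℕ} {B : Matrix (Fin p) (Fin p) ℝ}
    {θ : Fin (p / 2) → Fin 2} {k : Fin (p / 2)} (hk : decode n p B k ≠ θ k) :
    (perturbationScale n p * ((p - p / 2 : ℕ) : ℝ) / 2) ^ 2 ≤
      ((B - perturbedId n p θ) *ᵥ upperHalf p) (k.castLE (p.div_le_self 2)) ^ 2 := by
  rw [sub_mulVec, Pi.sub_apply, perturbedId_mulVec_upperHalf]
  have gap_nonneg : 0 ≤ perturbationScale n p * ((p - p / 2 : ℕ) : ℝ) :=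
    mul_nonneg (perturbationScale_nonneg n p) (Nat.cast_nonneg _)
  rw [decode] at hk
  split_ifs at hk with hB
  · have bit : θ k = 1 := by lia
    rw [bit, ← neg_sq (_ - _)]
    gcongr
    simp only [Fin.val_one, Nat.cast_one]
    linarith
  · have bit : θ k = 0 := by lia
    rw [bit]
    gcongr
    simp only [Fin.val_zero, Nat.cast_zero]
    linarith

open scoped Matrix.Norms.L2Operator in
theorem sum_mulVec_sq_le {m ι : Type*} [Fintype m] [Fintype ι] [DecidableEq ι]
    (M : Matrix m ι ℝ) (x : ι → ℝ) : ∑ i, (M *ᵥ x) i ^ 2 ≤ ‖M‖ ^ 2 * ∑ i, x i ^ 2 := by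
  have sq_le := pow_le_pow_left₀ (norm_nonneg _) (l2_opNorm_mulVec M (WithLp.toLp 2 x)) 2
  simpa [mul_pow, EuclideanSpace.real_norm_sq_eq] using sq_le

open scoped Matrix.Norms.L2Operator in
theorem hammingDist_decode_le_norm_sq (n : ℕ) {p : ℕ} (B : Matrix (Fin p) (Fin p) ℝ)
    (θ : Fin (p / 2) → Fin 2) :
    1 / (32 * (n : ℝ)) * hammingDist (decode n p B) θ ≤ ‖B - perturbedId n p θ‖ ^ 2 := by
  rcases p.eq_zero_or_pos with rfl | hp
  · simp [hammingDist]
  set v := (B - perturbedId n p θ) *ᵥ upperHalf p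
  set q : ℝ := ((p - p / 2 : ℕ) : ℝ) with hq
  have q_pos : 0 < q := by rw [hq]; exact mod_cast (by lia)
  have p_le : (p : ℝ) ≤ 2 * q := by rw [hq]; exact mod_cast (by lia)
  have norm_sq_ge : (perturbationScale n p * q / 2) ^ 2 * hammingDist (decode n p B) θ ≤
      ‖B - perturbedId n p θ‖ ^ 2 * q := by
    calc (perturbationScale n p * q / 2) ^ 2 * hammingDist (decode n p B) θ
        = ∑ k with decode n p B k ≠ θ k, (perturbationScale n p * q / 2) ^ 2 := by
          rw [Finset.sum_const, nsmul_eq_mul, mul_comm, hammingDist]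
      _ ≤ ∑ k with decode n p B k ≠ θ k, v (k.castLE (p.div_le_self 2)) ^ 2 :=
          Finset.sum_le_sum fun k hk => sq_le_mulVec_sq_of_decode_ne (Finset.mem_filter.1 hk).2
      _ ≤ ∑ k : Fin (p / 2), v (k.castLE (p.div_le_self 2)) ^ 2 :=
          Finset.sum_le_univ_sum_of_nonneg fun _ => sq_nonneg _
      _ = ∑ i ∈ Finset.univ.map (Fin.castLEEmb (p.div_le_self 2)), v i ^ 2 := by
          rw [Finset.sum_map]
          rfl
      _ ≤ ∑ i, v i ^ 2 := Finset.sum_le_univ_sum_of_nonneg fun _ => sq_nonneg _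
      _ ≤ ‖B - perturbedId n p θ‖ ^ 2 * q := by
          rw [hq, ← sum_upperHalf_sq]
          exact sum_mulVec_sq_le _ _
  refine le_of_mul_le_mul_right (le_trans ?_ norm_sq_ge) q_pos
  rw [mul_right_comm]
  gcongr
  rw [div_pow, mul_pow, perturbationScale_sq]
  have : (0 : ℝ) < p := mod_cast hp
  calc 1 / (32 * (n : ℝ)) * q = (1 / (32 * (n * p)) * q) * p := by field_simp
    _ ≤ (1 / (32 * (n * p)) * q) * (2 * q) := by gcongr
    _ = 1 / (4 * (n * p)) * q ^ 2 / 2 ^ 2 := by ring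

open scoped Matrix.Norms.L2Operator in
theorem ofReal_le_iSup_risk_perturbedFamily {n p : ℕ} (hpn : p ≤ n) {lam : ℝ} (hl : 0 < lam)
    (est : (Fin n → Fin p → ℤˣ) → Matrix (Fin p) (Fin p) ℝ) :
    ENNReal.ofReal (Real.exp (-2) / 64 * ((p / 2 : ℕ) / n)) ≤
      ⨆ S ∈ perturbedFamily n p, risk lam est S := by
  have lower := assouad (fun θ => sampleLaw n lam (perturbedId n p θ))
    (d := fun y => decode n p (est y)) .of_discrete
    (fun θ k A _ => ofReal_exp_neg_two_le_testing_error_perturbedId hpn hl θ k A)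
    (L := fun θ y => ENNReal.ofReal (‖est y - perturbedId n p θ‖ ^ 2))
    (δ := ENNReal.ofReal (1 / (32 * (n : ℝ)))) fun θ y => by
      rw [← ENNReal.ofReal_natCast, ← ENNReal.ofReal_mul (by positivity)]
      exact ENNReal.ofReal_le_ofReal (hammingDist_decode_le_norm_sq n (est y) θ)
  rw [perturbedFamily, iSup_range, ← ENNReal.mul_le_mul_iff_right two_ne_zero ENNReal.ofNat_ne_top]
  refine le_of_eq_of_le ?_ lower
  rw [← ENNReal.ofReal_ofNat, Fintype.card_fin, ← ENNReal.ofReal_natCast,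
    ← ENNReal.ofReal_mul (by positivity), ← ENNReal.ofReal_mul (by positivity),
    ← ENNReal.ofReal_mul (by positivity)]
  congr 1
  ring

end Separation

end DitheredCov

theorem mainTheorem4_general :
    ∃ c : ℝ, 0 < c ∧ ∀ (n p : ℕ), p ≠ 1 → p ≤ n → ∀ lam : ℝ, 0 < lam →
      ENNReal.ofReal (c * ((p : ℝ) / (n : ℝ))) ≤
        DitheredCov.minimaxRisk n p lam (DitheredCov.perturbedFamily n p) := by
  refine ⟨Real.exp (-2) / 192, by positivity, fun n p hp1 hpn lam hl => le_iInf fun est => ?_⟩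
  have p_le : (p : ℝ) ≤ 3 * (p / 2 : ℕ) := mod_cast (by lia)
  refine le_trans (ENNReal.ofReal_le_ofReal ?_)
    (DitheredCov.ofReal_le_iSup_risk_perturbedFamily hpn hl est)
  calc Real.exp (-2) / 192 * ((p : ℝ) / n) ≤ Real.exp (-2) / 192 * (3 * (p / 2 : ℕ) / n) := by
        gcongr
    _ = Real.exp (-2) / 64 * ((p / 2 : ℕ) / n) := by ring

theorem mainTheorem4 :
    ∃ c : ℝ, 0 < c ∧ ∀ (n p : ℕ), Even p → p < n → ∀ lam : ℝ, 0 < lam →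
      ENNReal.ofReal (c * ((p : ℝ) / (n : ℝ))) ≤
        DitheredCov.minimaxRisk n p lam (DitheredCov.perturbedFamily n p) :=
  let ⟨c, hc, risk_ge⟩ := mainTheorem4_general
  ⟨c, hc, fun n p hp hpn => risk_ge n p (by rintro rfl; simp at hp) hpn.le⟩
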